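/- **Setting.** For an integer $d\ge 1$ equip $\mathbb R^d$ with the Euclidean norm, and for $\Delta>0$ let $\mathcal F_d(\Delta)$ be the set of continuously differentiable functions $F:\mathbb R^d\to\mathbb R$ that are bounded below with $F(0)-\inf F\le\Delta$. A *stochastic first-order oracle* for $F$ consists of a probability distribution $\mathcal D$ on a measurable space $\mathcal Z$ and a measurable map $(x,\xi)\mapsto\nabla f(x,\xi)\in\mathbb R^d$ with $\mathbb E_{\xi\sim\mathcal D}[\nabla f(x,\xi)]=\nabla F(x)$ for all $x$; it answers a query $x$ with $(F(x),\nabla f(x,\xi))$. For $p\in(1,2]$, $q\in[1,2]$, $\bar L>0$, $\sigma_1\ge 0$ let $\mathcal O(F,\bar L^q,\sigma_1^p)$ be the set of those oracles for which, for all $x,y\in\mathbb R^d$, $$\mathbb E\|\nabla f(x,\xi)-\nabla F(x)\|^p\le\sigma_1^p\qquad\text{and}\qquad \mathbb E\|\nabla f(x,\xi)-\nabla f(y,\xi)\|^q\le\bar L^q\|x-y\|^q .$$ A randomized algorithm with batch size $K\ge 1$ draws a random seed $r$ once; in each round $i=1,2,\dots$ it issues $K$ queries $x^{(i)}=(x^{(i)}_1,\dots,x^{(i)}_K)$,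 a measurable function of $r$ and of all answers of the previous rounds, and all $K$ of them are answered with one common seed $\xi^{(i)}\sim\mathcal D$; the seeds $\xi^{(1)},\xi^{(2)},\dots$ and $r$ are independent. The algorithm is *zero-respecting* if, against every $C^1$ function on $\mathbb R^d$ and every stochastic first-order oracle for it, almost surely, for every $i$, each coordinate that is nonzero in some query of round $i$ is nonzero in some stochastic gradient received in a round before $i$. Let $\mathcal A_{\rm zr}(K)$ be the set of these algorithms (on $\mathbb R^d$), let $$T_\varepsilon(A,F,O)=\inf\{T\ge 1:\ \mathbb E\|\nabla F(x^{(T)}_k)\|\le\varepsilon\text{ for some }k\le K\},$$ and $$\mathfrak m^{\rm zr}_\varepsilon(K,\bar L,\Delta,\sigma_1^p)=\sup_{d\ge1}\ \sup_{F\in\mathcal F_d(\Delta)}\ \sup_{O\in\mathcal O(F,\bar L^q,\sigma_1^p)}\ \inf_{A\in\mathcal A_{\rm zr}(K)}T_\varepsilon(A,F,O)\in\mathbb N\cup\{\infty\}.$$ **Theorem.** There is a universal constant $c_1>0$, and for every $p\in(1,2]$ a constant $c>0$ depending only on $p$, such that for all $q\in[1,2]$, $K\ge1$, $\bar L,\Delta>0$,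 $\sigma_1\ge0$ and $0<\varepsilon\le c_1\sqrt{\bar L\Delta}$, $$\mathfrak m^{\rm zr}_\varepsilon(K,\bar L,\Delta,\sigma_1^p)\ \ge\ c\left(\Big(\frac{\sigma_1}{\varepsilon}\Big)^{\frac p{p-1}}+\frac{\bar L\Delta}{\varepsilon^2}+\frac{\bar L\Delta}{\varepsilon^2}\Big(\frac{\sigma_1}{\varepsilon}\Big)^{\frac p{q(p-1)}}\right).$$ Moreover, there are a dimension $d\ge 1$, a function $F\in\mathcal F_d(\Delta)$ and an oracle $O\in\mathcal O(F,\bar L^q,\sigma_1^p)$ such that every $A\in\mathcal A_{\rm zr}(K)$ has $T_\varepsilon(A,F,O)$ at least this large. In particular, for $p=q=2$ one has $\mathfrak m^{\rm zr}_\varepsilon\ge c\,\big(\sigma_1^2/\varepsilon^2+\bar L\Delta/\varepsilon^2+\bar L\Delta\sigma_1/\varepsilon^3\big)$, the form of the bound of Arjevani et al. -/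

import Mathlib

open MeasureTheory
open scoped ENNReal Gradient

universe u

noncomputable section

namespace HeavyTail

/-- Euclidean space of dimension `d`, with the Euclidean norm. -/
abbrev E (d : ℕ) : Type := EuclideanSpace ℝ (Fin d)

/-- The function class `𝓕(Δ)`: continuously differentiable functions on `ℝ^d` that are bounded
below and satisfy `F 0 - inf F ≤ Δ`. -/
def FunctionClass (d : ℕ) (Δ : ℝ) : Set (E d → ℝ) :=
  {F | ContDiff ℝ 1 F ∧ BddBelow (Set.range F) ∧ F 0 - ⨅ x, F x ≤ Δ}

/-- The answer to one query of a first-order oracle: a function value and a gradient estimate. -/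
abbrev Answer (d : ℕ) : Type := ℝ × E d

/-- A stochastic first-order oracle for `F`: a probability law on a measurable space of seeds and
an unbiased estimator of the gradient of `F`. -/
structure StochasticOracle {d : ℕ} (F : E d → ℝ) where
  /-- the space of oracle seeds -/
  Seed : Type
  /-- its sigma-algebra -/
  [measurableSpace : MeasurableSpace Seed]
  /-- the distribution of the oracle seed -/
  law : Measure Seed
  [isProbabilityMeasure : IsProbabilityMeasure law]
  /-- the stochastic gradient at a point, for a seed -/
  grad : E d → Seed → E d
  measurable_grad : Measurable (Function.uncurry grad)
  integrable_grad : ∀ x, Integrable (grad x) law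
  unbiased : ∀ x, ∫ ξ, grad x ξ ∂law = ∇ F x

attribute [instance] StochasticOracle.measurableSpace StochasticOracle.isProbabilityMeasure

namespace StochasticOracle

variable {d : ℕ} {F : E d → ℝ}

/-- The oracle answers a query `x` with `(F x, ∇f(x, ξ))`. -/
def answer (O : StochasticOracle F) (x : E d) (ξ : O.Seed) : Answer d := (F x, O.grad x ξ)

/-- `p`-bounded central moment of the stochastic gradients, with parameter `σ`. -/
def HasBoundedCentralMoment (O : StochasticOracle F) (p σ : ℝ) : Prop :=
  ∀ x, ∫⁻ ξ, ‖O.grad x ξ - ∇ F x‖ₑ ^ p ∂O.law ≤ ENNReal.ofReal σ ^ p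

/-- `q`-weak average smoothness of the stochastic gradients, with constant `L`. -/
def IsWeaklyAverageSmooth (O : StochasticOracle F) (q L : ℝ) : Prop :=
  ∀ x y, ∫⁻ ξ, ‖O.grad x ξ - O.grad y ξ‖ₑ ^ q ∂O.law ≤ ENNReal.ofReal L ^ q * ‖x - y‖ₑ ^ q

end StochasticOracle

/-- The class of first-order oracles for `F` that have `p`-bounded central moment with parameter `σ`
and are `q`-weakly average smooth with constant `L`. -/
def OracleClass {d : ℕ} (F : E d → ℝ) (p q L σ : ℝ) : Set (StochasticOracle F) :=
  {O | O.HasBoundedCentralMoment p σ ∧ O.IsWeaklyAverageSmooth q L}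

/-- A randomized first-order algorithm on `ℝ^d` that issues a batch of `K` queries per round:
a law of a random seed drawn once at the beginning, and measurable maps which produce the batch of
the next round from all the previous answers and the seed. `query i` is used after `i` completed
rounds. -/
structure Algorithm (d K : ℕ) where
  /-- the space of the algorithm's random seeds -/
  Seed : Type u
  /-- its sigma-algebra -/
  [measurableSpace : MeasurableSpace Seed]
  /-- the distribution of the algorithm's seed -/
  law : Measure Seed
  [isProbabilityMeasure : IsProbabilityMeasure law]
  /-- the batch issued after `i` rounds, from the `i` batches of answers and the seed -/
  query : (i : ℕ) → (Fin i → Fin K → Answer d) → Seed → Fin K → E d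
  measurable_query : ∀ i, Measurable (Function.uncurry (query i))

attribute [instance] Algorithm.measurableSpace Algorithm.isProbabilityMeasure

namespace Algorithm

variable {d K : ℕ} {F : E d → ℝ}

/-- Outcomes of the interaction: the algorithm's seed, and one oracle seed per round. -/
abbrev Outcome (A : Algorithm.{u} d K) (O : StochasticOracle F) : Type u := A.Seed × (ℕ → O.Seed)

/-- The law of the interaction: the algorithm's seed and the oracle seeds of the rounds are
independent, and the latter are identically distributed. -/
def outcomeLaw (A : Algorithm.{u} d K) (O : StochasticOracle F) : Measure (A.Outcome O) :=
  A.law.prod (Measure.infinitePi fun _ : ℕ => O.law)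

/-- The batches of answers received in the first `i` rounds. In each round the same oracle seed is
shared by all the queries of the batch. -/
def history (A : Algorithm.{u} d K) (O : StochasticOracle F) (ω : A.Outcome O) :
    (i : ℕ) → Fin i → Fin K → Answer d
  | 0 => Fin.elim0
  | i + 1 => Fin.snoc (α := fun _ => Fin K → Answer d) (history A O ω i)
      (fun k => O.answer (A.query i (history A O ω i) ω.1 k) (ω.2 i))

/-- The batch of queries of round `i + 1`. -/
def iterate (A : Algorithm.{u} d K) (O : StochasticOracle F) (i : ℕ) (ω : A.Outcome O) :
    Fin K → E d :=
  A.query i (A.history O ω i) ω.1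

/-- `A` is zero-respecting: against every continuously differentiable function and every stochastic
first-order oracle for it, almost surely, a coordinate that is nonzero in some query of a round was
nonzero in some stochastic gradient received in an earlier round. -/
def IsZeroRespecting (A : Algorithm.{u} d K) : Prop :=
  ∀ F : E d → ℝ, ContDiff ℝ 1 F → ∀ O : StochasticOracle F,
    ∀ᵐ ω ∂A.outcomeLaw O, ∀ (i : ℕ) (k : Fin K) (c : Fin d), A.iterate O i ω k c ≠ 0 →
      ∃ j < i, ∃ l : Fin K, O.grad (A.iterate O j ω l) (ω.2 j) c ≠ 0

/-- Some query of the batch of round `i + 1` is an `ε`-stationary point in expectation. -/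
def IsStationaryAt (A : Algorithm.{u} d K) (O : StochasticOracle F) (ε : ℝ) (i : ℕ) : Prop :=
  ∃ k : Fin K, ∫⁻ ω, ‖∇ F (A.iterate O i ω k)‖ₑ ∂A.outcomeLaw O ≤ ENNReal.ofReal ε

/-- The first round `T ≥ 1` whose batch contains an `ε`-stationary point in expectation
(infinite if there is none). -/
def roundsToStationary (A : Algorithm.{u} d K) (O : StochasticOracle F) (ε : ℝ) : ℕ∞ :=
  ⨅ (i : ℕ) (_ : A.IsStationaryAt O ε i), ((i + 1 : ℕ) : ℕ∞)

end Algorithm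

/-- The complexity of finding `ε`-stationary points with zero-respecting algorithms that issue
batches of `K` queries: the supremum over dimensions `d ≥ 1`, functions in `𝓕(Δ)` and oracles in
the class of the infimum over zero-respecting algorithms of the number of rounds. -/
def complexity (p q : ℝ) (K : ℕ) (L Δ σ ε : ℝ) : ℕ∞ :=
  ⨆ (d : ℕ) (_ : 1 ≤ d) (F : E d → ℝ) (_ : F ∈ FunctionClass d Δ)
    (O : StochasticOracle F) (_ : O ∈ OracleClass F p q L σ),
    ⨅ (A : Algorithm.{u} d K) (_ : A.IsZeroRespecting), A.roundsToStationary O ε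

/-- The rate `(σ/ε)^(p/(p-1)) + LΔ/ε² + (LΔ/ε²) (σ/ε)^(p/(q(p-1)))`. -/
def rate (p q L Δ σ ε : ℝ) : ℝ :=
  (σ / ε) ^ (p / (p - 1)) + L * Δ / ε ^ 2 + L * Δ / ε ^ 2 * (σ / ε) ^ (p / (q * (p - 1)))

end HeavyTail

end

/-! The hard instance is a chain of `d` coordinates that can only be discovered in order, and its
oracle shows the next coordinate only when a coin of bias `ρ` falls on heads. The gradient stays
large while any coordinate vanishes (`one_le_norm_chainGrad`). A whole batch shares one coin, so a
round unlocks at most one coordinate whatever `K` is (`iterate_eq_zero`). The expected number of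
heads after `i` rounds is `i * ρ`, so about `d / ρ` rounds are needed (`le_of_isStationaryAt`).

The noise multiplies an auxiliary field `chainReveal`, not the gradient itself. Beyond the
discovered coordinates this field agrees with the gradient, yet at every point it has at most one
nonzero entry (`chainReveal_ne_zero_unique`). It is globally Lipschitz and bounded independently of
`d`, so the noise and smoothness conditions can be checked outcome by outcome.

Scale the gradient to size `2 * ε` and write `W = 1 / ρ`. The `p`-th moment of the noise is of order
`ε ^ p * W ^ (p - 1)`, which permits `W` of order `(σ / ε) ^ (p / (p - 1))`. At length scale `l` the
`q`-average Lipschitz constant is of order `(ε / l) * W ^ (1 - 1 / q)`, which fixes `l`. The budget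
`Δ` then permits `d` of order `L * Δ / (ε ^ 2 * W ^ (1 - 1 / q))`, and `d * W` is the third term of
the rate. If the budget does not cover one link of this chain, `W` dominates the rate. A
one-dimensional chain with a constant revealing field then suffices (`singleLink`), since constant
noise does not affect smoothness. -/

noncomputable section

namespace HeavyTail

/-! ### One-dimensional building blocks -/

/-- Half the square of the positive part. -/
def halfSq (t : ℝ) : ℝ := (max t 0) ^ 2 / 2

theorem hasDerivAt_halfSq (t : ℝ) : HasDerivAt halfSq (max t 0) t := by
  rw [hasDerivAt_iff_isLittleO]
  -- The first-order Taylor remainder is bounded by the square of the increment.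
  refine Asymptotics.IsBigO.trans_isLittleO (g := fun s => (s - t) ^ 2) ?_ ?_
  · refine Asymptotics.IsBigO.of_bound 1 (Filter.Eventually.of_forall fun s => ?_)
    simp only [halfSq, smul_eq_mul, Real.norm_eq_abs, one_mul, abs_pow, sq_abs]
    rw [abs_le]
    rcases le_total s 0 with hs | hs <;> rcases le_total t 0 with ht | ht <;>
      simp only [max_eq_left, max_eq_right, hs, ht] <;> constructor <;> nlinarith
  · simpa using Asymptotics.isLittleO_pow_sub_sub t one_lt_two

/-- The penalty for negative coordinates. -/
def penalty (t : ℝ) : ℝ := halfSq (-t)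

/-- The derivative of `penalty`. -/
def penaltyDeriv (t : ℝ) : ℝ := min t 0

/-- A continuously differentiable monotone step from `0` on `(-∞, 1]` to `1` on `[3, ∞)`. -/
def step (t : ℝ) : ℝ := halfSq (t - 1) - 2 * halfSq (t - 2) + halfSq (t - 3)

/-- The derivative of `step`. -/
def stepDeriv (t : ℝ) : ℝ := max 0 (min (t - 1) (3 - t))

/-- A continuously differentiable monotone ramp from `0` on `(-∞, -1]` to `4` on `[4, ∞)`, of slope
one on `[0, 3]`. -/
def ramp (t : ℝ) : ℝ := halfSq (t + 1) - halfSq t - halfSq (t - 3) + halfSq (t - 4)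

/-- The derivative of `ramp`. -/
def rampDeriv (t : ℝ) : ℝ := max 0 (min (min 1 (t + 1)) (4 - t))

theorem hasDerivAt_halfSq_add (a t : ℝ) :
    HasDerivAt (fun s => halfSq (s + a)) (max (t + a) 0) t :=
  (hasDerivAt_halfSq (t + a)).comp_add_const t a

theorem hasDerivAt_halfSq_sub (a t : ℝ) :
    HasDerivAt (fun s => halfSq (s - a)) (max (t - a) 0) t :=
  (hasDerivAt_halfSq (t - a)).comp_sub_const t a

theorem hasDerivAt_penalty (t : ℝ) : HasDerivAt penalty (penaltyDeriv t) t := by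
  have h := (hasDerivAt_halfSq (-t)).scomp t (hasDerivAt_neg t)
  refine HasDerivAt.congr_deriv (f := penalty) h ?_
  simp only [penaltyDeriv, smul_eq_mul]
  grind

theorem hasDerivAt_step (t : ℝ) : HasDerivAt step (stepDeriv t) t := by
  have h := ((hasDerivAt_halfSq_sub 1 t).sub ((hasDerivAt_halfSq_sub 2 t).const_mul 2)).add
    (hasDerivAt_halfSq_sub 3 t)
  refine HasDerivAt.congr_deriv (f := step) h ?_
  simp only [stepDeriv]
  grind

theorem hasDerivAt_ramp (t : ℝ) : HasDerivAt ramp (rampDeriv t) t := by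
  have h := (((hasDerivAt_halfSq_add 1 t).sub (hasDerivAt_halfSq t)).sub
    (hasDerivAt_halfSq_sub 3 t)).add (hasDerivAt_halfSq_sub 4 t)
  refine HasDerivAt.congr_deriv (f := ramp) h ?_
  simp only [rampDeriv]
  grind

theorem penalty_nonneg (t : ℝ) : 0 ≤ penalty t := by
  unfold penalty halfSq; positivity

theorem penalty_zero : penalty 0 = 0 := by simp [penalty, halfSq]

theorem abs_penaltyDeriv_sub_le (s t : ℝ) : |penaltyDeriv s - penaltyDeriv t| ≤ |s - t| := by
  simp only [penaltyDeriv]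
  grind

theorem stepDeriv_nonneg (t : ℝ) : 0 ≤ stepDeriv t := le_max_left _ _

theorem stepDeriv_le_one (t : ℝ) : stepDeriv t ≤ 1 := by
  simp only [stepDeriv]; grind

theorem stepDeriv_zero : stepDeriv 0 = 0 := by norm_num [stepDeriv]

theorem abs_stepDeriv_sub_le (s t : ℝ) : |stepDeriv s - stepDeriv t| ≤ |s - t| := by
  simp only [stepDeriv]
  grind

theorem rampDeriv_nonneg (t : ℝ) : 0 ≤ rampDeriv t := le_max_left _ _

theorem rampDeriv_le_one (t : ℝ) : rampDeriv t ≤ 1 := by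
  simp only [rampDeriv]; grind

theorem rampDeriv_zero : rampDeriv 0 = 1 := by norm_num [rampDeriv]

theorem abs_rampDeriv_sub_le (s t : ℝ) : |rampDeriv s - rampDeriv t| ≤ |s - t| := by
  simp only [rampDeriv]
  grind

/-- Left of `3`, the penalty and the ramp together have slope at least one. -/
theorem penaltyDeriv_sub_rampDeriv_le {t : ℝ} (ht : t < 3) :
    penaltyDeriv t - rampDeriv t ≤ -1 := by
  simp only [penaltyDeriv, rampDeriv]; grind

theorem abs_sub_le_of_hasDerivAt {f f' : ℝ → ℝ} (hf : ∀ t, HasDerivAt f (f' t) t)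
    (h0 : ∀ t, 0 ≤ f' t) (h1 : ∀ t, f' t ≤ 1) (s t : ℝ) : |f s - f t| ≤ |s - t| := by
  have := Convex.norm_image_sub_le_of_norm_hasDerivWithin_le (f := f) (f' := f') (C := 1)
    (s := Set.univ) (x := t) (y := s) (fun x _ => (hf x).hasDerivWithinAt)
    (fun x _ => by rw [Real.norm_eq_abs, abs_of_nonneg (h0 x)]; exact h1 x) convex_univ
    trivial trivial
  simpa using this

theorem monotone_of_hasDerivAt {f f' : ℝ → ℝ} (hf : ∀ t, HasDerivAt f (f' t) t)
    (h0 : ∀ t, 0 ≤ f' t) : Monotone f :=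
  monotone_of_deriv_nonneg (fun t => (hf t).differentiableAt) fun t => by
    rw [(hf t).deriv]; exact h0 t

theorem abs_step_sub_le (s t : ℝ) : |step s - step t| ≤ |s - t| :=
  abs_sub_le_of_hasDerivAt hasDerivAt_step stepDeriv_nonneg stepDeriv_le_one s t

theorem abs_ramp_sub_le (s t : ℝ) : |ramp s - ramp t| ≤ |s - t| :=
  abs_sub_le_of_hasDerivAt hasDerivAt_ramp rampDeriv_nonneg rampDeriv_le_one s t

theorem step_of_le {t : ℝ} (ht : t ≤ 1) : step t = 0 := by
  rw [step, halfSq, halfSq, halfSq, max_eq_right (by linarith), max_eq_right (by linarith),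
    max_eq_right (by linarith)]
  norm_num

theorem step_of_ge {t : ℝ} (ht : 3 ≤ t) : step t = 1 := by
  rw [step, halfSq, halfSq, halfSq, max_eq_left (by linarith), max_eq_left (by linarith),
    max_eq_left (by linarith)]
  ring

theorem step_nonneg (t : ℝ) : 0 ≤ step t := by
  rw [← step_of_le (min_le_right t 1)]
  exact monotone_of_hasDerivAt hasDerivAt_step stepDeriv_nonneg (min_le_left t 1)

theorem step_le_one (t : ℝ) : step t ≤ 1 := by
  rw [← step_of_ge (le_max_right t 3)]
  exact monotone_of_hasDerivAt hasDerivAt_step stepDeriv_nonneg (le_max_left t 3)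

theorem ramp_of_le {t : ℝ} (ht : t ≤ -1) : ramp t = 0 := by
  rw [ramp, halfSq, halfSq, halfSq, halfSq, max_eq_right (by linarith), max_eq_right (by linarith),
    max_eq_right (by linarith), max_eq_right (by linarith)]
  norm_num

theorem ramp_of_ge {t : ℝ} (ht : 4 ≤ t) : ramp t = 4 := by
  rw [ramp, halfSq, halfSq, halfSq, halfSq, max_eq_left (by linarith), max_eq_left (by linarith),
    max_eq_left (by linarith), max_eq_left (by linarith)]
  ring

theorem ramp_nonneg (t : ℝ) : 0 ≤ ramp t := by
  rw [← ramp_of_le (min_le_right t (-1))]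
  exact monotone_of_hasDerivAt hasDerivAt_ramp rampDeriv_nonneg (min_le_left t (-1))

theorem ramp_le_four (t : ℝ) : ramp t ≤ 4 := by
  rw [← ramp_of_ge (le_max_right t 4)]
  exact monotone_of_hasDerivAt hasDerivAt_ramp rampDeriv_nonneg (le_max_left t 4)

/-! ### The chain function -/

variable {d : ℕ}

/-- The coordinates of `x`, preceded by a virtual coordinate in the saturated range of `step` and
followed by virtual coordinates in the null range of `ramp`. -/
def padded (x : E d) : ℕ → ℝ
  | 0 => 3
  | i + 1 => if h : i < d then x ⟨i, h⟩ else -1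

/-- The difference of two padded sequences, as a linear function of the difference vector. -/
def shifted (z : E d) : ℕ → ℝ
  | 0 => 0
  | i + 1 => if h : i < d then z ⟨i, h⟩ else 0

theorem padded_succ (x : E d) (i : Fin d) : padded x (i + 1) = x i := by simp [padded]

theorem shifted_succ (x : E d) (i : Fin d) : shifted x (i + 1) = x i := by simp [shifted]

theorem padded_sub (x y : E d) (n : ℕ) : padded x n - padded y n = shifted (x - y) n := by
  cases n with
  | zero => simp [padded, shifted]
  | succ n => simp only [padded, shifted]; split_ifs <;> simp

/-- The hard function, a chain in which a coordinate matters only once its predecessor is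
large. -/
def chainFun (x : E d) : ℝ :=
  ∑ i : Fin d, (penalty (x i) - step (padded x i) * ramp (x i))

/-- The gradient of `chainFun`. -/
def chainGrad (x : E d) : E d :=
  WithLp.toLp 2 fun i => penaltyDeriv (x i) - step (padded x i) * rampDeriv (x i)
    - stepDeriv (x i) * ramp (padded x (i + 2))

theorem chainGrad_apply (x : E d) (i : Fin d) : chainGrad x i =
    penaltyDeriv (x i) - step (padded x i) * rampDeriv (x i)
      - stepDeriv (x i) * ramp (padded x (i + 2)) := rfl

/-- The coordinates from the `i`-th on. -/
def tailPart (i : ℕ) (x : E d) : E d := WithLp.toLp 2 fun j => if i ≤ j then x j else 0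

theorem tailPart_apply (i : ℕ) (x : E d) (j : Fin d) :
    tailPart i x j = if i ≤ j then x j else 0 := rfl

/-- The part of the gradient of the chain function that reveals the next coordinate. -/
def chainReveal (x : E d) : E d :=
  WithLp.toLp 2 fun i => -(step (padded x i) * max 0 (1 - ‖tailPart i x‖))

theorem chainReveal_apply (x : E d) (i : Fin d) :
    chainReveal x i = -(step (padded x i) * max 0 (1 - ‖tailPart i x‖)) := rfl

theorem hasFDerivAt_coord (x : E d) (i : Fin d) :
    HasFDerivAt (fun y : E d => y i) (EuclideanSpace.proj i : E d →L[ℝ] ℝ) x :=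
  (EuclideanSpace.proj i : E d →L[ℝ] ℝ).hasFDerivAt

/-- The coordinate functionals of `shifted`. -/
def shiftedCLM (n : ℕ) : E d →L[ℝ] ℝ :=
  match n with
  | 0 => 0
  | i + 1 => if h : i < d then EuclideanSpace.proj ⟨i, h⟩ else 0

theorem shiftedCLM_apply (n : ℕ) (z : E d) : shiftedCLM n z = shifted z n := by
  cases n with
  | zero => rfl
  | succ n => simp only [shiftedCLM, shifted]; split_ifs <;> simp

theorem hasFDerivAt_padded (x : E d) (n : ℕ) :
    HasFDerivAt (fun y : E d => padded y n) (shiftedCLM n) x := by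
  cases n with
  | zero => exact hasFDerivAt_const _ _
  | succ n =>
    simp only [padded, shiftedCLM]
    split_ifs with h
    · exact hasFDerivAt_coord x _
    · exact hasFDerivAt_const _ _

theorem hasGradientAt_chainFun (x : E d) : HasGradientAt chainFun (chainGrad x) x := by
  rw [hasGradientAt_iff_hasFDerivAt]
  have h := HasFDerivAt.fun_sum (u := Finset.univ) fun (i : Fin d) _ =>
    HasFDerivAt.fun_sub
      ((hasDerivAt_penalty (x i)).comp_hasFDerivAt x (hasFDerivAt_coord x i))
      (HasFDerivAt.fun_mul
        ((hasDerivAt_step (padded x i)).comp_hasFDerivAt x (hasFDerivAt_padded x i))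
        ((hasDerivAt_ramp (x i)).comp_hasFDerivAt x (hasFDerivAt_coord x i)))
  refine HasFDerivAt.congr_fderiv (f := chainFun) h ?_
  ext z
  -- Each coordinate also occurs in the `step` factor of the next link; shifting the index collects
  -- both occurrences. The boundary terms vanish because the virtual predecessor is constant and the
  -- virtual successor `-1` lies where `ramp` is zero.
  have key : ∑ i : Fin d, stepDeriv (padded x i) * shifted z i * ramp (x i)
      = ∑ i : Fin d, stepDeriv (x i) * z i * ramp (padded x (i + 2)) := by
    set A : ℕ → ℝ := fun n => stepDeriv (padded x n) * shifted z n * ramp (padded x (n + 1))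
    have h1 : ∀ i : Fin d, stepDeriv (padded x i) * shifted z i * ramp (x i) = A i := fun i => by
      simp only [A, padded_succ]
    have h2 : ∀ i : Fin d, stepDeriv (x i) * z i * ramp (padded x (i + 2)) = A (i + 1) := fun i => by
      simp only [A, padded_succ, shifted_succ]
    simp_rw [h1, h2]
    rw [Fin.sum_univ_eq_sum_range A, Fin.sum_univ_eq_sum_range (fun n => A (n + 1))]
    have h3 := Finset.sum_range_succ A d
    rw [Finset.sum_range_succ'] at h3
    have h4 : A 0 = 0 := by simp [A, shifted]
    have h5 : A d = 0 := by simp [A, padded, ramp_of_le]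
    linarith
  have hproj : ∀ i : Fin d, (EuclideanSpace.proj i : E d →L[ℝ] ℝ) z = z i := fun _ => rfl
  simp only [Function.comp_def, _root_.sum_apply, _root_.sub_apply, _root_.add_apply,
    _root_.smul_apply, shiftedCLM_apply, hproj, smul_eq_mul, InnerProductSpace.toDual_apply_apply, PiLp.inner_apply,
    RCLike.inner_apply, conj_trivial, chainGrad_apply]
  have : ∀ i : Fin d, z i * (penaltyDeriv (x i) - step (padded x i) * rampDeriv (x i)
      - stepDeriv (x i) * ramp (padded x (i + 2))) =
      z i * (penaltyDeriv (x i) - step (padded x i) * rampDeriv (x i))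
        - stepDeriv (x i) * z i * ramp (padded x (i + 2)) := fun i => by ring
  simp_rw [this, Finset.sum_sub_distrib (f := fun i => z i * _), ← key, ← Finset.sum_sub_distrib]
  exact Finset.sum_congr rfl fun i _ => by ring

/-! ### Lipschitz bound for the gradient of the chain -/

theorem abs_mul_sub_mul_le {a a' b b' A B : ℝ} (ha : |a| ≤ A) (hb : |b'| ≤ B) :
    |a * b - a' * b'| ≤ A * |b - b'| + B * |a - a'| := by
  have : a * b - a' * b' = a * (b - b') + b' * (a - a') := by ring
  rw [this]
  refine (abs_add_le _ _).trans ?_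
  rw [abs_mul, abs_mul]
  gcongr

/-- The coupling is between neighbours only. The middle weight is `1 + 1 + 4`: penalty, slope of the
ramp, and `stepDeriv` multiplied by a ramp of height at most `4`. -/
theorem abs_chainGrad_sub_le (x y : E d) (i : Fin d) : |chainGrad x i - chainGrad y i| ≤
    |shifted (x - y) i| + 6 * |shifted (x - y) (i + 1)| + |shifted (x - y) (i + 2)| := by
  rw [← padded_sub, ← padded_sub, ← padded_sub, padded_succ, padded_succ, chainGrad_apply,
    chainGrad_apply]
  have h1 := abs_penaltyDeriv_sub_le (x i) (y i)
  have h2 := abs_mul_sub_mul_le (a := step (padded x i)) (a' := step (padded y i))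
    (b := rampDeriv (x i)) (b' := rampDeriv (y i)) (A := 1) (B := 1)
    (by rw [abs_of_nonneg (step_nonneg _)]; exact step_le_one _)
    (by rw [abs_of_nonneg (rampDeriv_nonneg _)]; exact rampDeriv_le_one _)
  have h3 := abs_mul_sub_mul_le (a := stepDeriv (x i)) (a' := stepDeriv (y i))
    (b := ramp (padded x (i + 2))) (b' := ramp (padded y (i + 2))) (A := 1) (B := 4)
    (by rw [abs_of_nonneg (stepDeriv_nonneg _)]; exact stepDeriv_le_one _)
    (by rw [abs_of_nonneg (ramp_nonneg _)]; exact ramp_le_four _)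
  have h4 := abs_rampDeriv_sub_le (x i) (y i)
  have h5 := abs_step_sub_le (padded x i) (padded y i)
  have h6 := abs_stepDeriv_sub_le (x i) (y i)
  have h7 := abs_ramp_sub_le (padded x (i + 2)) (padded y (i + 2))
  rw [abs_le] at h1 h2 h3 ⊢
  constructor <;> linarith [h1.1, h1.2, h2.1, h2.2, h3.1, h3.2]

theorem norm_sq_eq_sum (x : E d) : ‖x‖ ^ 2 = ∑ i, x i ^ 2 := by
  simp [EuclideanSpace.norm_sq_eq]

theorem sum_shifted_sq_le (z : E d) (k : ℕ) (hk : k ≤ 2) :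
    ∑ i : Fin d, shifted z (i + k) ^ 2 ≤ ‖z‖ ^ 2 := by
  rw [norm_sq_eq_sum]
  have h1 : ∑ i : Fin d, z i ^ 2 = ∑ n ∈ Finset.range (d + 2), shifted z n ^ 2 := by
    rw [Finset.sum_range_succ, Finset.sum_range_succ',
      ← Fin.sum_univ_eq_sum_range (fun n => shifted z (n + 1) ^ 2)]
    simp only [shifted_succ]
    simp [shifted]
  have h2 : ∑ i : Fin d, shifted z (i + k) ^ 2 = ∑ n ∈ Finset.Ico k (d + k), shifted z n ^ 2 := by
    rw [Fin.sum_univ_eq_sum_range (fun n => shifted z (n + k) ^ 2), Finset.sum_Ico_eq_sum_range]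
    simp [add_comm]
  rw [h1, h2]
  refine Finset.sum_le_sum_of_subset_of_nonneg (fun n hn => ?_) fun _ _ _ => sq_nonneg _
  simp only [Finset.mem_Ico, Finset.mem_range] at hn ⊢
  omega

theorem norm_chainGrad_sub_le (x y : E d) : ‖chainGrad x - chainGrad y‖ ≤ 8 * ‖x - y‖ := by
  refine le_of_sq_le_sq ?_ (by positivity)
  rw [norm_sq_eq_sum, mul_pow]
  set z := x - y
  -- Cauchy–Schwarz with weights `1, 6, 1`; their sum `8` appears here and once more after summing
  -- over `i`, giving `8 ^ 2`.
  have h : ∀ i : Fin d, (chainGrad x - chainGrad y) i ^ 2 ≤ 8 * (shifted z (i + 0) ^ 2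
      + 6 * shifted z (i + 1) ^ 2 + shifted z (i + 2) ^ 2) := fun i => by
    rw [PiLp.sub_apply, ← sq_abs, ← sq_abs (shifted z _), ← sq_abs (shifted z (i + 1)),
      ← sq_abs (shifted z (i + 2)), add_zero]
    have h1 := abs_chainGrad_sub_le x y i
    have h2 := pow_le_pow_left₀ (abs_nonneg _) h1 2
    refine h2.trans ?_
    nlinarith [sq_nonneg (|shifted z i| - |shifted z (i + 1)|),
      sq_nonneg (|shifted z (i + 2)| - |shifted z (i + 1)|),
      sq_nonneg (|shifted z i| - |shifted z (i + 2)|)]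
  refine (Finset.sum_le_sum fun i _ => h i).trans ?_
  rw [← Finset.mul_sum, Finset.sum_add_distrib, Finset.sum_add_distrib, ← Finset.mul_sum]
  linarith [sum_shifted_sq_le z 0 (by simp), sum_shifted_sq_le z 1 (by simp),
    sum_shifted_sq_le z 2 le_rfl]

/-! ### The revealing field -/

theorem tailPart_sub (i : ℕ) (x y : E d) : tailPart i (x - y) = tailPart i x - tailPart i y := by
  ext j
  simp only [tailPart_apply, PiLp.sub_apply]
  split_ifs <;> simp

theorem norm_tailPart_le (i : ℕ) (x : E d) : ‖tailPart i x‖ ≤ ‖x‖ := by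
  refine le_of_sq_le_sq ?_ (norm_nonneg x)
  rw [norm_sq_eq_sum, norm_sq_eq_sum]
  refine Finset.sum_le_sum fun j _ => ?_
  rw [tailPart_apply]
  split_ifs
  · exact le_rfl
  · simpa using sq_nonneg (x j)

theorem norm_le_of_support (w : E d) (S : Finset (Fin d)) (hS : ∀ i, w i ≠ 0 → i ∈ S) {C c : ℝ}
    (hC : ∀ i, |w i| ≤ C) (hc : 0 ≤ c) (h : S.card * C ^ 2 ≤ c ^ 2) : ‖w‖ ≤ c := by
  refine le_of_sq_le_sq (le_trans ?_ h) hc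
  rw [norm_sq_eq_sum, ← Finset.sum_subset (Finset.subset_univ S) fun i _ hi => by
    rw [not_imp_comm.1 (hS i) hi]; norm_num]
  rw [← nsmul_eq_mul]
  refine Finset.sum_le_card_nsmul _ _ _ fun i _ => ?_
  rw [← sq_abs]
  exact pow_le_pow_left₀ (abs_nonneg _) (hC i) 2

theorem abs_coord_le_norm (x : E d) (i : Fin d) : |x i| ≤ ‖x‖ := by
  simpa using PiLp.norm_apply_le x i

/-- If `i < j` were both active, the predecessor of `j` would exceed `1`, since `step` vanishes up
to `1`. But it lies in the tail from `i` on, whose norm is below `1`. -/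
theorem chainReveal_ne_zero_unique {x : E d} {i j : Fin d} (hi : chainReveal x i ≠ 0)
    (hj : chainReveal x j ≠ 0) : i = j := by
  wlog h : i < j generalizing i j
  · rcases (not_lt.1 h).eq_or_lt with h' | h'
    · exact h'.symm
    · exact (this hj hi h').symm
  exfalso
  rw [chainReveal_apply, neg_ne_zero] at hi hj
  have h1 : ‖tailPart i x‖ < 1 := by
    by_contra! hle
    exact right_ne_zero_of_mul hi (max_eq_left (by linarith))
  obtain ⟨n, hn⟩ : ∃ n, (j : ℕ) = n + 1 := ⟨j - 1, by have := Fin.lt_def.1 h; omega⟩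
  have hnd : n < d := by have := j.2; omega
  have h2 : 1 < x ⟨n, hnd⟩ := by
    by_contra! hle
    refine left_ne_zero_of_mul hj (step_of_le ?_)
    rw [hn]
    simpa [padded, hnd] using hle
  have h3 := abs_coord_le_norm (tailPart i x) ⟨n, hnd⟩
  rw [tailPart_apply, if_pos (by have := Fin.lt_def.1 h; simp only; omega)] at h3
  linarith [le_abs_self (x ⟨n, hnd⟩)]

theorem abs_chainReveal_le (x : E d) (i : Fin d) : |chainReveal x i| ≤ 1 := by
  rw [chainReveal_apply, abs_neg, abs_mul, abs_of_nonneg (step_nonneg _),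
    abs_of_nonneg (le_max_left _ _)]
  exact mul_le_one₀ (step_le_one _) (le_max_left _ _)
    (max_le zero_le_one (by linarith [norm_nonneg (tailPart i x)]))

theorem card_chainReveal_support_le (x : E d) :
    (Finset.univ.filter fun i => chainReveal x i ≠ 0).card ≤ 1 :=
  Finset.card_le_one.2 fun i hi j hj => by
    simp only [Finset.mem_filter, Finset.mem_univ, true_and] at hi hj
    exact chainReveal_ne_zero_unique hi hj

theorem norm_chainReveal_le (x : E d) : ‖chainReveal x‖ ≤ 1 := by
  refine norm_le_of_support _ (Finset.univ.filter fun i => chainReveal x i ≠ 0) (by simp)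
    (abs_chainReveal_le x) zero_le_one ?_
  have : ((Finset.univ.filter fun i => chainReveal x i ≠ 0).card : ℝ) ≤ 1 := by
    exact_mod_cast card_chainReveal_support_le x
  linarith

theorem abs_shifted_le_norm (z : E d) (n : ℕ) : |shifted z n| ≤ ‖z‖ := by
  cases n with
  | zero => simp [shifted]
  | succ n =>
    simp only [shifted]
    split_ifs
    · exact abs_coord_le_norm z _
    · simp

theorem abs_chainReveal_sub_le (x y : E d) (i : Fin d) :
    |chainReveal x i - chainReveal y i| ≤ 2 * ‖x - y‖ := by
  rw [chainReveal_apply, chainReveal_apply, neg_sub_neg, abs_sub_comm]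
  have h1 := abs_mul_sub_mul_le (a := step (padded x i)) (a' := step (padded y i))
    (b := max 0 (1 - ‖tailPart i x‖)) (b' := max 0 (1 - ‖tailPart i y‖)) (A := 1) (B := 1)
    (by rw [abs_of_nonneg (step_nonneg _)]; exact step_le_one _)
    (by rw [abs_of_nonneg (le_max_left _ _)]
        exact max_le zero_le_one (by linarith [norm_nonneg (tailPart i y)]))
  have h2 : |max 0 (1 - ‖tailPart i x‖) - max 0 (1 - ‖tailPart i y‖)| ≤
      |‖tailPart i x‖ - ‖tailPart i y‖| := by grind
  have h3 : |‖tailPart i x‖ - ‖tailPart i y‖| ≤ ‖x - y‖ := by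
    refine (abs_norm_sub_norm_le _ _).trans ?_
    rw [← tailPart_sub]
    exact norm_tailPart_le _ _
  have h4 := abs_step_sub_le (padded x i) (padded y i)
  rw [padded_sub] at h4
  linarith [abs_shifted_le_norm (x - y) i]

/-- The difference lives on at most two coordinates, one for each point, so the coordinatewise bound
passes to the norm without a factor depending on `d`: `2 * 2 ^ 2 ≤ 4 ^ 2`. -/
theorem norm_chainReveal_sub_le (x y : E d) : ‖chainReveal x - chainReveal y‖ ≤ 4 * ‖x - y‖ := by
  refine norm_le_of_support _ ((Finset.univ.filter fun i => chainReveal x i ≠ 0) ∪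
    (Finset.univ.filter fun i => chainReveal y i ≠ 0)) (fun i hi => ?_)
    (abs_chainReveal_sub_le x y) (by positivity) ?_
  · simp only [Finset.mem_union, Finset.mem_filter, Finset.mem_univ, true_and]
    by_contra! h
    exact hi (by rw [PiLp.sub_apply, h.1, h.2, sub_zero])
  · have h : (((Finset.univ.filter fun i => chainReveal x i ≠ 0) ∪
        (Finset.univ.filter fun i => chainReveal y i ≠ 0)).card : ℝ) ≤ 2 := by
      exact_mod_cast (Finset.card_union_le _ _).trans
        (add_le_add (card_chainReveal_support_le x) (card_chainReveal_support_le y))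
    nlinarith [sq_nonneg ‖x - y‖]

theorem padded_eq_zero {k : ℕ} {x : E d} (hx : ∀ j : Fin d, k ≤ j → x j = 0) (j : Fin d)
    (hj : k + 1 ≤ j) : padded x j = 0 := by
  obtain ⟨n, hn⟩ : ∃ n, (j : ℕ) = n + 1 := ⟨j - 1, by omega⟩
  have hnd : n < d := by have := j.2; omega
  rw [hn]
  simp only [padded, hnd, dif_pos]
  exact hx _ (by simp only; omega)

theorem chainReveal_eq_zero {k : ℕ} {x : E d} (hx : ∀ j : Fin d, k ≤ j → x j = 0) (j : Fin d)
    (hj : k + 1 ≤ j) : chainReveal x j = 0 := by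
  rw [chainReveal_apply, padded_eq_zero hx j hj, step_of_le zero_le_one]
  simp

/-- With a vanishing tail the cut-off factor equals `1`, the slope of the ramp at `0` is `1`, and
the penalty and `stepDeriv` contribute nothing. -/
theorem chainGrad_eq_chainReveal {k : ℕ} {x : E d} (hx : ∀ j : Fin d, k ≤ j → x j = 0)
    (j : Fin d) (hj : k ≤ j) : chainGrad x j = chainReveal x j := by
  have h : tailPart j x = 0 := by
    ext l
    rw [tailPart_apply]
    split_ifs with hl
    · exact hx l (hj.trans hl)
    · rfl
  rw [chainGrad_apply, chainReveal_apply, hx j hj, h, stepDeriv_zero, rampDeriv_zero]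
  simp [penaltyDeriv]

/-- The first coordinate below `3` has a predecessor (possibly the virtual one) that saturates
`step`. Its partial derivative is then at most `-1`, as the remaining coupling term only lowers it.
-/
theorem one_le_norm_chainGrad {x : E d} {j : Fin d} (hj : x j = 0) : 1 ≤ ‖chainGrad x‖ := by
  classical
  have hex : ∃ n, padded x (n + 1) < 3 := ⟨j, by rw [padded_succ, hj]; norm_num⟩
  set n := Nat.find hex
  have hn : padded x (n + 1) < 3 := Nat.find_spec hex
  have hnd : n < d := lt_of_le_of_lt (Nat.find_min' hex (by rw [padded_succ, hj]; norm_num)) j.2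
  have hprev : 3 ≤ padded x n := by
    cases hm : n with
    | zero => exact le_rfl
    | succ m => exact not_lt.1 (Nat.find_min hex (m := m) (by omega))
  have hval : x ⟨n, hnd⟩ < 3 := by rw [← padded_succ]; exact hn
  refine le_trans ?_ (abs_coord_le_norm (chainGrad x) ⟨n, hnd⟩)
  rw [chainGrad_apply, step_of_ge (t := padded x n) hprev, le_abs]
  right
  have := penaltyDeriv_sub_rampDeriv_le hval
  have := mul_nonneg (stepDeriv_nonneg (x ⟨n, hnd⟩)) (ramp_nonneg (padded x (n + 2)))
  simp only
  linarith

theorem chainFun_zero_sub_le (x : E d) : chainFun (0 : E d) - chainFun x ≤ 4 * d := by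
  have h0 : chainFun (0 : E d) ≤ 0 := Finset.sum_nonpos fun i _ => by
    rw [PiLp.zero_apply, penalty_zero]
    linarith [mul_nonneg (step_nonneg (padded (0 : E d) i)) (ramp_nonneg 0)]
  have hx : -(4 * (d : ℝ)) ≤ chainFun x := by
    have : ∑ _i : Fin d, (-4 : ℝ) ≤ chainFun x := Finset.sum_le_sum fun i _ => by
      have h1 := mul_le_mul (step_le_one (padded x i)) (ramp_le_four (x i)) (ramp_nonneg _)
        zero_le_one
      linarith [penalty_nonneg (x i)]
    simp at this
    linarith
  linarith

/-! ### Zero-chains -/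

/-- A function `F` with gradient `G` together with a vector field `v` that carries, at points
supported on the first `k` coordinates, the `k`-th coordinate of the gradient. The gradient has norm
at least `γ` wherever a coordinate vanishes. -/
structure ZeroChain (d : ℕ) (a b γ D : ℝ) where
  F : E d → ℝ
  G : E d → E d
  v : E d → E d
  hasGradientAt : ∀ x, HasGradientAt F (G x) x
  norm_G_sub_le : ∀ x y, ‖G x - G y‖ ≤ a * ‖x - y‖
  norm_v_sub_le : ∀ x y, ‖v x - v y‖ ≤ b * ‖x - y‖
  norm_v_le : ∀ x, ‖v x‖ ≤ γ
  G_eq_v : ∀ (k : ℕ) (x : E d), (∀ j : Fin d, k ≤ j → x j = 0) → ∀ j : Fin d, k ≤ j → G x j = v x j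
  v_eq_zero : ∀ (k : ℕ) (x : E d), (∀ j : Fin d, k ≤ j → x j = 0) → ∀ j : Fin d, k + 1 ≤ j → v x j = 0
  le_norm_G : ∀ x (j : Fin d), x j = 0 → γ ≤ ‖G x‖
  zero_sub_le : ∀ x, F 0 - F x ≤ D

/-- The chain function as a zero-chain. -/
def chain (d : ℕ) : ZeroChain d 8 4 1 (4 * d) where
  F := chainFun
  G := chainGrad
  v := chainReveal
  hasGradientAt := hasGradientAt_chainFun
  norm_G_sub_le := norm_chainGrad_sub_le
  norm_v_sub_le := norm_chainReveal_sub_le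
  norm_v_le := norm_chainReveal_le
  G_eq_v := fun _ _ hx => chainGrad_eq_chainReveal hx
  v_eq_zero := fun _ _ hx => chainReveal_eq_zero hx
  le_norm_G := fun _ _ hj => one_le_norm_chainGrad hj
  zero_sub_le := chainFun_zero_sub_le

theorem norm_chainGrad_zero_le : ‖chainGrad (0 : E 1)‖ ≤ 1 := by
  refine norm_le_of_support _ Finset.univ (fun _ _ => Finset.mem_univ _) (C := 1) (fun i => ?_)
    zero_le_one (by simp)
  rw [chainGrad_apply, PiLp.zero_apply, stepDeriv_zero, rampDeriv_zero]
  simp only [penaltyDeriv, min_self, mul_one, zero_mul, sub_zero, zero_sub, abs_neg]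
  rw [abs_of_nonneg (step_nonneg _)]
  exact step_le_one _

/-- The one-dimensional chain, in which the gradient at the origin is revealed at random. -/
def singleLink : ZeroChain 1 8 0 1 4 where
  F := chainFun
  G := chainGrad
  v := fun _ => chainGrad 0
  hasGradientAt := hasGradientAt_chainFun
  norm_G_sub_le := norm_chainGrad_sub_le
  norm_v_sub_le := by simp
  norm_v_le := fun _ => norm_chainGrad_zero_le
  -- In dimension one a vanishing tail containing an index forces `x = 0`, where the constant field
  -- is the gradient.
  G_eq_v := fun k x hx j hj => by
    rw [show x = 0 from by ext i; rw [Subsingleton.elim i j]; exact hx j hj]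
  v_eq_zero := fun k x hx j hj => by have := j.2; omega
  le_norm_G := fun _ _ hj => one_le_norm_chainGrad hj
  zero_sub_le := fun x => by simpa using chainFun_zero_sub_le x

namespace ZeroChain

variable {a b γ D : ℝ}

/-- Rescaling of the argument by `l` and of the gradient by `s`. -/
def scale (C : ZeroChain d a b γ D) {s l : ℝ} (hs : 0 < s) (hl : 0 < l) :
    ZeroChain d (s * (a / l)) (s * (b / l)) (s * γ) (s * l * D) where
  F x := s * l * C.F (l⁻¹ • x)
  G x := s • C.G (l⁻¹ • x)
  v x := s • C.v (l⁻¹ • x)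
  hasGradientAt x := by
    have h := ((C.hasGradientAt (l⁻¹ • x)).hasFDerivAt.comp x
      ((hasFDerivAt_id (𝕜 := ℝ) x).const_smul l⁻¹)).const_mul (s * l)
    rw [hasGradientAt_iff_hasFDerivAt]
    refine HasFDerivAt.congr_fderiv (f := fun x => s * l * C.F (l⁻¹ • x)) h ?_
    ext z
    simp
    field_simp
  norm_G_sub_le x y := by
    have := C.norm_G_sub_le (l⁻¹ • x) (l⁻¹ • y)
    rw [← smul_sub, norm_smul, Real.norm_of_nonneg (inv_nonneg.2 hl.le)] at this
    rw [← smul_sub, norm_smul, Real.norm_of_nonneg hs.le, mul_assoc, div_eq_mul_inv, mul_assoc]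
    gcongr
  norm_v_sub_le x y := by
    have := C.norm_v_sub_le (l⁻¹ • x) (l⁻¹ • y)
    rw [← smul_sub, norm_smul, Real.norm_of_nonneg (inv_nonneg.2 hl.le)] at this
    rw [← smul_sub, norm_smul, Real.norm_of_nonneg hs.le, mul_assoc, div_eq_mul_inv, mul_assoc]
    gcongr
  norm_v_le x := by
    rw [norm_smul, Real.norm_of_nonneg hs.le]
    exact mul_le_mul_of_nonneg_left (C.norm_v_le _) hs.le
  G_eq_v k x hx j hj := by
    simp only [PiLp.smul_apply]
    rw [C.G_eq_v k (l⁻¹ • x) (fun i hi => by simp [hx i hi]) j hj]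
  v_eq_zero k x hx j hj := by
    simp only [PiLp.smul_apply]
    rw [C.v_eq_zero k (l⁻¹ • x) (fun i hi => by simp [hx i hi]) j hj, smul_zero]
  le_norm_G x j hj := by
    rw [norm_smul, Real.norm_of_nonneg hs.le]
    exact mul_le_mul_of_nonneg_left (C.le_norm_G _ j (by simp [hj])) hs.le
  zero_sub_le x := by
    rw [smul_zero, ← mul_sub]
    exact mul_le_mul_of_nonneg_left (C.zero_sub_le _) (by positivity)

theorem continuous_of_norm_sub_le {f : E d → E d} {c : ℝ} (h : ∀ x y, ‖f x - f y‖ ≤ c * ‖x - y‖) :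
    Continuous f :=
  (LipschitzWith.of_dist_le_mul (K := c.toNNReal) fun x y => by
    rw [dist_eq_norm, dist_eq_norm]
    exact (h x y).trans (mul_le_mul_of_nonneg_right (Real.le_coe_toNNReal c)
      (norm_nonneg _))).continuous

variable (C : ZeroChain d a b γ D)

theorem gradient_eq (x : E d) : ∇ C.F x = C.G x := (C.hasGradientAt x).gradient

theorem continuous_G : Continuous C.G := continuous_of_norm_sub_le C.norm_G_sub_le

theorem continuous_v : Continuous C.v := continuous_of_norm_sub_le C.norm_v_sub_le

theorem contDiff : ContDiff ℝ 1 C.F := by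
  rw [contDiff_one_iff_hasFDerivAt]
  exact ⟨fun x => InnerProductSpace.toDual ℝ (E d) (C.G x),
    (InnerProductSpace.toDual ℝ (E d)).continuous.comp C.continuous_G,
    fun x => (C.hasGradientAt x).hasFDerivAt⟩

theorem mem_functionClass {Δ : ℝ} (h : D ≤ Δ) : C.F ∈ FunctionClass d Δ := by
  have hle : ∀ x, C.F 0 - D ≤ C.F x := fun x => by linarith [C.zero_sub_le x]
  exact ⟨C.contDiff, ⟨C.F 0 - D, by rintro _ ⟨x, rfl⟩; exact hle x⟩, by linarith [le_ciInf hle]⟩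

end ZeroChain

/-! ### The Bernoulli oracle -/

/-- The Bernoulli law with parameter `ρ`. -/
def coin (ρ : ℝ) : Measure Bool :=
  ENNReal.ofReal (1 - ρ) • Measure.dirac false + ENNReal.ofReal ρ • Measure.dirac true

theorem lintegral_coin (ρ : ℝ) (f : Bool → ℝ≥0∞) :
    ∫⁻ z, f z ∂coin ρ = ENNReal.ofReal (1 - ρ) * f false + ENNReal.ofReal ρ * f true := by
  rw [coin, lintegral_add_measure, lintegral_smul_measure, lintegral_smul_measure,
    lintegral_dirac, lintegral_dirac, smul_eq_mul, smul_eq_mul]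

theorem isProbabilityMeasure_coin {ρ : ℝ} (h0 : 0 ≤ ρ) (h1 : ρ ≤ 1) :
    IsProbabilityMeasure (coin ρ) := ⟨by
  rw [← setLIntegral_one, Measure.restrict_univ, lintegral_coin, mul_one, mul_one,
    ← ENNReal.ofReal_add (by linarith) h0, sub_add_cancel, ENNReal.ofReal_one]⟩

theorem integrable_coin (ρ : ℝ) (f : Bool → E d) : Integrable f (coin ρ) := by
  refine Integrable.add_measure ?_ ?_ <;>
    exact Integrable.smul_measure (integrable_dirac (by simp)) ENNReal.ofReal_ne_top

theorem integral_coin {ρ : ℝ} (h0 : 0 ≤ ρ) (h1 : ρ ≤ 1) (f : Bool → E d) :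
    ∫ z, f z ∂coin ρ = (1 - ρ) • f false + ρ • f true := by
  rw [coin, integral_add_measure, integral_smul_measure, integral_smul_measure, integral_dirac,
    integral_dirac, ENNReal.toReal_ofReal (by linarith), ENNReal.toReal_ofReal h0]
  all_goals exact Integrable.smul_measure (integrable_dirac (by simp)) ENNReal.ofReal_ne_top

/-- The centred and normalized value of a coin: mean zero. -/
def centred (ρ : ℝ) (z : Bool) : ℝ := bif z then ρ⁻¹ - 1 else -1

namespace ZeroChain

variable {a b γ D : ℝ}

/-- The oracle that reveals the field `v` only if the coin shows `true`. -/
def oracle (C : ZeroChain d a b γ D) {ρ : ℝ} (h0 : 0 < ρ) (h1 : ρ ≤ 1) : StochasticOracle C.F :=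
  letI := isProbabilityMeasure_coin h0.le h1
  { Seed := Bool
    law := coin ρ
    grad := fun x z => C.G x + centred ρ z • C.v x
    measurable_grad := measurable_from_prod_countable_left fun z =>
      (C.continuous_G.add (C.continuous_v.const_smul (centred ρ z))).measurable
    integrable_grad := fun x => integrable_coin ρ _
    unbiased := fun x => by
      rw [integral_coin h0.le h1, C.gradient_eq]
      simp only [centred, cond_true, cond_false]
      have : ρ * ρ⁻¹ = 1 := mul_inv_cancel₀ h0.ne'
      rw [smul_add, smul_add, smul_smul, smul_smul, add_add_add_comm, ← add_smul, ← add_smul,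
        mul_sub, this]
      simp }

variable (C : ZeroChain d a b γ D) {ρ : ℝ} (h0 : 0 < ρ) (h1 : ρ ≤ 1)

theorem oracle_grad (x : E d) (z : Bool) :
    (C.oracle h0 h1).grad x z = C.G x + centred ρ z • C.v x := rfl

theorem lintegral_coin_ofReal {f : Bool → ℝ} (h0 : 0 ≤ ρ) (h1 : ρ ≤ 1) (hf : ∀ z, 0 ≤ f z) (r : ℝ)
    (hr : 0 ≤ r) : ∫⁻ z, ENNReal.ofReal (f z) ^ r ∂coin ρ =
      ENNReal.ofReal ((1 - ρ) * f false ^ r + ρ * f true ^ r) := by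
  have hf' := fun z => Real.rpow_nonneg (hf z) r
  rw [lintegral_coin, ENNReal.ofReal_rpow_of_nonneg (hf _) hr,
    ENNReal.ofReal_rpow_of_nonneg (hf _) hr, ← ENNReal.ofReal_mul (by linarith),
    ← ENNReal.ofReal_mul h0, ENNReal.ofReal_add]
  · exact mul_nonneg (by linarith) (hf' _)
  · exact mul_nonneg h0 (hf' _)

theorem hasBoundedCentralMoment_oracle {p σ : ℝ} (hp : 0 ≤ p) (hσ : 0 ≤ σ) (hγ : 0 ≤ γ)
    (h : (1 - ρ) * γ ^ p + ρ * ((ρ⁻¹ - 1) * γ) ^ p ≤ σ ^ p) :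
    (C.oracle h0 h1).HasBoundedCentralMoment p σ := by
  intro x
  have hinv : 0 ≤ ρ⁻¹ - 1 := sub_nonneg.2 ((one_le_inv₀ h0).2 h1)
  have hbd : ∀ z : Bool, ‖(C.oracle h0 h1).grad x z - ∇ C.F x‖ₑ ≤
      ENNReal.ofReal (|centred ρ z| * γ) := fun z => by
    rw [oracle_grad, C.gradient_eq, add_sub_cancel_left, ← ofReal_norm, norm_smul]
    exact ENNReal.ofReal_le_ofReal (mul_le_mul_of_nonneg_left (C.norm_v_le x) (abs_nonneg _))
  calc _ ≤ ∫⁻ z, ENNReal.ofReal (|centred ρ z| * γ) ^ p ∂coin ρ :=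
        lintegral_mono fun z => ENNReal.rpow_le_rpow (hbd z) hp
    _ = _ := lintegral_coin_ofReal h0.le h1 (fun z => by positivity) p hp
    _ ≤ ENNReal.ofReal (σ ^ p) := by
        refine ENNReal.ofReal_le_ofReal ?_
        simpa [centred, abs_of_nonneg hinv] using h
    _ = _ := (ENNReal.ofReal_rpow_of_nonneg hσ hp).symm

/-- For each outcome of the coin the stochastic gradient is Lipschitz with a deterministic constant,
so only a two-point average of constants remains. -/
theorem isWeaklyAverageSmooth_oracle {q L : ℝ} (hq : 0 ≤ q) (hL : 0 ≤ L) (ha : 0 ≤ a) (hb : 0 ≤ b)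
    (h : (1 - ρ) * (a + b) ^ q + ρ * (a + (ρ⁻¹ - 1) * b) ^ q ≤ L ^ q) :
    (C.oracle h0 h1).IsWeaklyAverageSmooth q L := by
  intro x y
  have hinv : 0 ≤ ρ⁻¹ - 1 := sub_nonneg.2 ((one_le_inv₀ h0).2 h1)
  have hbd : ∀ z : Bool, ‖(C.oracle h0 h1).grad x z - (C.oracle h0 h1).grad y z‖ₑ ≤
      ENNReal.ofReal (a + |centred ρ z| * b) * ‖x - y‖ₑ := fun z => by
    rw [oracle_grad, oracle_grad, add_sub_add_comm, ← smul_sub, ← ofReal_norm,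
      ← ofReal_norm, ← ENNReal.ofReal_mul (by positivity)]
    refine ENNReal.ofReal_le_ofReal ((norm_add_le _ _).trans ?_)
    rw [norm_smul, Real.norm_eq_abs, add_mul, mul_assoc]
    exact add_le_add (C.norm_G_sub_le x y)
      (mul_le_mul_of_nonneg_left (C.norm_v_sub_le x y) (abs_nonneg _))
  calc _ ≤ ∫⁻ z, ENNReal.ofReal (a + |centred ρ z| * b) ^ q * ‖x - y‖ₑ ^ q ∂coin ρ :=
        lintegral_mono fun z => by
          rw [← ENNReal.mul_rpow_of_nonneg _ _ hq]
          exact ENNReal.rpow_le_rpow (hbd z) hq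
    _ = (∫⁻ z, ENNReal.ofReal (a + |centred ρ z| * b) ^ q ∂coin ρ) * ‖x - y‖ₑ ^ q :=
        lintegral_mul_const _ (Measurable.of_discrete)
    _ ≤ ENNReal.ofReal (L ^ q) * ‖x - y‖ₑ ^ q := by
        rw [lintegral_coin_ofReal h0.le h1 (fun z => by positivity) q hq]
        refine mul_le_mul_left (ENNReal.ofReal_le_ofReal ?_) _
        simpa [centred, abs_of_nonneg hinv] using h
    _ = _ := by rw [ENNReal.ofReal_rpow_of_nonneg hL hq]

/-! ### Progress of zero-respecting algorithms -/

/-- The number of heads among the first `i` coins. -/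
def heads (z : ℕ → Bool) (i : ℕ) : ℕ := ∑ j ∈ Finset.range i, (z j).toNat

theorem heads_succ (z : ℕ → Bool) (i : ℕ) : heads z (i + 1) = heads z i + (z i).toNat :=
  Finset.sum_range_succ _ _

theorem heads_mono (z : ℕ → Bool) : Monotone (heads z) :=
  monotone_nat_of_le_succ fun i => by rw [heads_succ]; exact Nat.le_add_right _ _

/-- Tails give the factor `-1`, which cancels the gradient against the field beyond `k`; heads can
expose coordinate `k` but nothing further. -/
theorem oracle_grad_eq_zero {k : ℕ} {x : E d} (hx : ∀ j : Fin d, k ≤ j → x j = 0) (z : Bool)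
    (j : Fin d) (hj : k + z.toNat ≤ j) : (C.oracle h0 h1).grad x z j = 0 := by
  rw [oracle_grad, PiLp.add_apply, PiLp.smul_apply, C.G_eq_v k x hx j (by omega)]
  cases z
  · simp [centred]
  · rw [C.v_eq_zero k x hx j hj]
    simp

theorem iterate_eq_zero {K : ℕ} (A : Algorithm.{u} d K) (ω : A.Outcome (C.oracle h0 h1))
    (hω : ∀ (i : ℕ) (k : Fin K) (c : Fin d), A.iterate (C.oracle h0 h1) i ω k c ≠ 0 →
      ∃ j < i, ∃ l : Fin K,
        (C.oracle h0 h1).grad (A.iterate (C.oracle h0 h1) j ω l) (ω.2 j) c ≠ 0)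
    (i : ℕ) (k : Fin K) (c : Fin d) (hc : heads ω.2 i ≤ c) :
    A.iterate (C.oracle h0 h1) i ω k c = 0 := by
  induction i using Nat.strong_induction_on generalizing k c with
  | _ i ih =>
    by_contra hne
    obtain ⟨j, hji, l, hl⟩ := hω i k c hne
    refine hl (C.oracle_grad_eq_zero h0 h1 (ih j hji l) (ω.2 j) c (le_trans ?_ hc))
    -- The coin of round `j` is already counted among those before round `i`, as `j < i`.
    exact (heads_succ ω.2 j).symm.trans_le (heads_mono ω.2 hji)

theorem lintegral_heads {K : ℕ} (A : Algorithm.{u} d K) (i : ℕ) :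
    ∫⁻ ω, (heads ω.2 i : ℝ≥0∞) ∂A.outcomeLaw (C.oracle h0 h1) = i * ENNReal.ofReal ρ := by
  have hmeas : ∀ j : ℕ, MeasurePreserving (fun ω : A.Outcome (C.oracle h0 h1) => ω.2 j)
      (A.outcomeLaw (C.oracle h0 h1)) (C.oracle h0 h1).law := fun j =>
    (measurePreserving_eval_infinitePi (fun _ : ℕ => (C.oracle h0 h1).law) j).comp
      measurePreserving_snd
  have hbool : Measurable fun z : Bool => ((z.toNat : ℕ) : ℝ≥0∞) := Measurable.of_discrete
  have hone : ∀ j : ℕ, ∫⁻ ω, ((Bool.toNat (ω.2 j) : ℕ) : ℝ≥0∞) ∂A.outcomeLaw (C.oracle h0 h1)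
      = ENNReal.ofReal ρ := fun j => by
    refine ((hmeas j).lintegral_comp (f := fun z : Bool => ((z.toNat : ℕ) : ℝ≥0∞)) hbool).trans ?_
    exact (lintegral_coin ρ _).trans (by simp)
  simp only [heads, Nat.cast_sum]
  rw [lintegral_finsetSum]
  · simp [hone]
  · exact fun j _ => hbool.comp (hmeas j).measurable

theorem measurable_heads {K : ℕ} (A : Algorithm.{u} d K) (i : ℕ) :
    Measurable fun ω : A.Outcome (C.oracle h0 h1) => (heads ω.2 i : ℝ≥0∞) := by
  simp only [heads, Nat.cast_sum]
  exact Finset.measurable_fun_sum _ fun j _ =>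
    (Measurable.of_discrete (f := fun z : Bool => ((z.toNat : ℕ) : ℝ≥0∞))).comp
      ((measurable_pi_apply j).comp measurable_snd)

/-- On average, a zero-respecting algorithm makes progress at rate at most `ρ`. -/
theorem le_of_isStationaryAt {K : ℕ} (A : Algorithm.{u} d K) (hA : A.IsZeroRespecting) (hd : 1 ≤ d)
    {ε : ℝ} (hε : 0 < ε) (hγ : 2 * ε ≤ γ) {i : ℕ}
    (hi : A.IsStationaryAt (C.oracle h0 h1) ε i) : (d : ℝ) / (2 * ρ) ≤ i := by
  obtain ⟨k, hk⟩ := hi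
  have hd0 : (0 : ℝ) < d := by exact_mod_cast hd
  set μ := A.outcomeLaw (C.oracle h0 h1)
  have : IsProbabilityMeasure μ := by
    unfold μ Algorithm.outcomeLaw; infer_instance
  -- A linear form of Markov's inequality: with fewer than `d` heads some coordinate is still zero
  -- and the gradient is large; otherwise the second summand alone is at least `2 * ε`.
  have hae : ∀ᵐ ω ∂μ, ENNReal.ofReal (2 * ε) ≤
      ‖∇ C.F (A.iterate (C.oracle h0 h1) i ω k)‖ₑ +
        ENNReal.ofReal (2 * ε / d) * (heads ω.2 i : ℝ≥0∞) := by
    filter_upwards [hA C.F C.contDiff (C.oracle h0 h1)] with ω hω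
    by_cases hlt : heads ω.2 i < d
    · refine le_add_right ?_
      rw [C.gradient_eq, ← ofReal_norm]
      refine ENNReal.ofReal_le_ofReal (hγ.trans (C.le_norm_G _ ⟨_, hlt⟩ ?_))
      exact C.iterate_eq_zero h0 h1 A ω hω i k _ le_rfl
    · refine le_add_left ?_
      rw [← ENNReal.ofReal_natCast, ← ENNReal.ofReal_mul (by positivity)]
      refine ENNReal.ofReal_le_ofReal ?_
      have : (d : ℝ) ≤ heads ω.2 i := by exact_mod_cast not_lt.1 hlt
      calc 2 * ε = 2 * ε / d * d := by field_simp
        _ ≤ _ := by gcongr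
  have hint := lintegral_mono_ae hae
  rw [lintegral_const, measure_univ, mul_one, lintegral_add_right _
    ((C.measurable_heads h0 h1 A i).const_mul _),
    lintegral_const_mul _ (C.measurable_heads h0 h1 A i), C.lintegral_heads h0 h1 A i] at hint
  have h2 := hint.trans (add_le_add_left hk _)
  rw [← ENNReal.ofReal_natCast, ← ENNReal.ofReal_mul (by positivity),
    ← ENNReal.ofReal_mul (by positivity), ← ENNReal.ofReal_add (by positivity) (by positivity),
    ENNReal.ofReal_le_ofReal_iff (by positivity)] at h2
  rw [div_le_iff₀ (by positivity)]
  -- Stationarity absorbs one `ε` of the `2 * ε`; the other must be paid for by expected heads.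
  have h3 : ε ≤ ε * (2 * (i * ρ) / d) := by
    calc ε ≤ 2 * ε / d * (i * ρ) := by linarith
      _ = _ := by ring
  have h4 := le_of_mul_le_mul_left ((mul_one ε).trans_le h3) hε
  rw [le_div_iff₀ hd0] at h4
  linarith

theorem le_roundsToStationary {K : ℕ} (A : Algorithm.{u} d K) (hA : A.IsZeroRespecting)
    (hd : 1 ≤ d) {ε : ℝ} (hε : 0 < ε) (hγ : 2 * ε ≤ γ) :
    ((⌈(d : ℝ) / (2 * ρ)⌉₊ : ℕ) : ℕ∞) ≤ A.roundsToStationary (C.oracle h0 h1) ε := by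
  refine le_iInf₂ fun i hi => ?_
  have h := Nat.ceil_le.2 (C.le_of_isStationaryAt h0 h1 A hA hd hε hγ hi)
  -- Index `i` stands for round `i + 1`, so one round is given away.
  exact_mod_cast h.trans (Nat.le_succ i)

end ZeroChain

/-! ### The choice of parameters -/

theorem moment_coin_le {ρ p : ℝ} (h0 : 0 < ρ) (h1 : ρ ≤ 1) (hp : 1 ≤ p) :
    (1 - ρ) + ρ * (ρ⁻¹ - 1) ^ p ≤ 2 * (ρ⁻¹) ^ (p - 1) := by
  have hinv : 1 ≤ ρ⁻¹ := (one_le_inv₀ h0).2 h1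
  have h2 : 1 ≤ (ρ⁻¹) ^ (p - 1) := Real.one_le_rpow hinv (by linarith)
  have h3 : ρ * (ρ⁻¹ - 1) ^ p ≤ (ρ⁻¹) ^ (p - 1) := by
    calc ρ * (ρ⁻¹ - 1) ^ p ≤ ρ * (ρ⁻¹) ^ p := by
          gcongr
          linarith
      _ = ρ * ((ρ⁻¹) ^ (p - 1) * ρ⁻¹) := by
          rw [← Real.rpow_add_one (by positivity), sub_add_cancel]
      _ = _ := by field_simp
  linarith

/-- The mean number of rounds per revealed coordinate. -/
def waitingTime (p σ ε : ℝ) : ℝ := max 1 ((σ / (4 * ε)) ^ (p / (p - 1)))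

theorem one_le_waitingTime (p σ ε : ℝ) : 1 ≤ waitingTime p σ ε := le_max_left _ _

theorem moment_waitingTime_le {p σ ε : ℝ} (hp : 1 < p) (hσ : 0 ≤ σ) (hε : 0 < ε) :
    (1 - (waitingTime p σ ε)⁻¹) * (2 * ε) ^ p +
      (waitingTime p σ ε)⁻¹ * (((waitingTime p σ ε)⁻¹⁻¹ - 1) * (2 * ε)) ^ p ≤ σ ^ p := by
  have h1 := one_le_waitingTime p σ ε
  have hp0 : 0 < p := by linarith
  have hp1 : 0 < p - 1 := by linarith
  rcases h1.eq_or_lt with h | h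
  -- With `W = 1` the coin always shows heads and the oracle is exact.
  · rw [← h, inv_one, inv_one, sub_self, zero_mul, zero_mul, Real.zero_rpow hp0.ne', mul_zero,
      add_zero]
    exact Real.rpow_nonneg hσ p
  · have hW : waitingTime p σ ε = (σ / (4 * ε)) ^ (p / (p - 1)) := by
      rw [waitingTime] at h ⊢
      exact max_eq_right (by by_contra! h'; rw [max_eq_left h'.le] at h; exact lt_irrefl _ h)
    set W := waitingTime p σ ε
    have hmom := moment_coin_le (ρ := W⁻¹) (by positivity) (inv_le_one_of_one_le₀ h1) hp.le
    have hpow : W ^ (p - 1) = (σ / (4 * ε)) ^ p := by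
      rw [hW, ← Real.rpow_mul (by positivity), div_mul_cancel₀ _ hp1.ne']
    have h2 : (2 : ℝ) ≤ 2 ^ p := by
      simpa using Real.rpow_le_rpow_of_exponent_le (x := 2) one_le_two hp.le
    rw [inv_inv] at hmom ⊢
    rw [Real.mul_rpow (x := W - 1) (by linarith) (by positivity)]
    -- The `4` in `waitingTime` is `2 * 2`: one factor cancels the gradient size `2 * ε`, the other
    -- absorbs the two outcomes through `2 ≤ 2 ^ p`.
    calc _ = (1 - W⁻¹ + W⁻¹ * (W - 1) ^ p) * (2 * ε) ^ p := by ring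
      _ ≤ 2 ^ p * (σ / (4 * ε)) ^ p * (2 * ε) ^ p := by
          rw [← hpow]
          gcongr
          exact hmom.trans (by gcongr)
      _ = σ ^ p := by
          rw [← Real.mul_rpow (by positivity) (by positivity),
            ← Real.mul_rpow (by positivity) (by positivity)]
          congr 1
          field_simp
          ring

/-- Both outcomes contribute at most `(12 * s) ^ q * W ^ (q - 1)`; the rare one has constant at most
`12 * s * W` and probability `W⁻¹`. Doubling `12` to `24` pays for adding them. -/
theorem smoothness_le {W q : ℝ} (hW : 1 ≤ W) (hq : 1 ≤ q) {s : ℝ} (hs : 0 ≤ s) :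
    (1 - W⁻¹) * (s * 8 + s * 4) ^ q + W⁻¹ * (s * 8 + (W⁻¹⁻¹ - 1) * (s * 4)) ^ q ≤
      (24 * W ^ (1 - 1 / q) * s) ^ q := by
  have hW0 : 0 < W := by linarith
  have hq0 : 0 < q := by linarith
  have hWq : 1 ≤ W ^ (q - 1) := Real.one_le_rpow hW (by linarith)
  have h1 : (W ^ (1 - 1 / q)) ^ q = W ^ (q - 1) := by
    rw [← Real.rpow_mul hW0.le]
    congr 1
    field_simp
  have h2 : (2 : ℝ) ≤ 2 ^ q := by
    simpa using Real.rpow_le_rpow_of_exponent_le (x := 2) one_le_two hq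
  have h3 : W⁻¹ * (s * 8 + (W - 1) * (s * 4)) ^ q ≤ (12 * s) ^ q * W ^ (q - 1) := by
    calc W⁻¹ * (s * 8 + (W - 1) * (s * 4)) ^ q ≤ W⁻¹ * (12 * s * W) ^ q := by
          have : s ≤ s * W := le_mul_of_one_le_right hs hW
          have : 0 ≤ (W - 1) * (s * 4) := mul_nonneg (by linarith) (by linarith)
          gcongr
          nlinarith
      _ = (12 * s) ^ q * W ^ (q - 1) := by
          rw [Real.mul_rpow (by positivity) hW0.le, Real.rpow_sub_one hW0.ne']
          ring
  have h4 : (1 - W⁻¹) * (s * 8 + s * 4) ^ q ≤ (12 * s) ^ q * W ^ (q - 1) := by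
    rw [show s * 8 + s * 4 = 12 * s by ring]
    have : 0 ≤ (12 * s) ^ q := by positivity
    have : 0 ≤ W⁻¹ := by positivity
    nlinarith
  rw [inv_inv]
  calc _ ≤ 2 * ((12 * s) ^ q * W ^ (q - 1)) := by linarith
    _ ≤ 2 ^ q * ((12 * s) ^ q * W ^ (q - 1)) := by gcongr
    _ = _ := by
      rw [← h1, ← Real.mul_rpow (by positivity) (by positivity),
        ← Real.mul_rpow (by positivity) (by positivity)]
      congr 1
      ring

/-- The complexity of all zero-respecting algorithms on a scaled zero-chain with a Bernoulli
oracle. -/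
theorem exists_hard_instance {d : ℕ} {a b D : ℝ} (C : ZeroChain d a b 1 D) (hd : 1 ≤ d)
    (ha : 0 ≤ a) (hb : 0 ≤ b) {p q L Δ σ ε l : ℝ} (hp : 1 < p) (hq : 1 ≤ q) (hL : 0 < L)
    (hσ : 0 ≤ σ) (hε : 0 < ε) (hl : 0 < l) (hD : 2 * ε * l * D ≤ Δ)
    (hsmooth : (1 - (waitingTime p σ ε)⁻¹) * (2 * ε * (a / l) + 2 * ε * (b / l)) ^ q +
      (waitingTime p σ ε)⁻¹ *
        (2 * ε * (a / l) + ((waitingTime p σ ε)⁻¹⁻¹ - 1) * (2 * ε * (b / l))) ^ q ≤ L ^ q)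
    {r : ℝ} (hr : r ≤ d * waitingTime p σ ε / 2) (K : ℕ) :
    ∃ F ∈ FunctionClass d Δ, ∃ O ∈ OracleClass F p q L σ,
      ∀ A : Algorithm.{u} d K, A.IsZeroRespecting →
        ((⌈r⌉₊ : ℕ) : ℕ∞) ≤ A.roundsToStationary O ε := by
  have hW := one_le_waitingTime p σ ε
  set W := waitingTime p σ ε
  have h0 : 0 < W⁻¹ := by positivity
  have h1 : W⁻¹ ≤ 1 := inv_le_one_of_one_le₀ hW
  let C' := C.scale (s := 2 * ε) (by positivity) hl
  refine ⟨C'.F, C'.mem_functionClass hD, C'.oracle h0 h1, ⟨?_, ?_⟩, fun A hA => ?_⟩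
  · refine C'.hasBoundedCentralMoment_oracle h0 h1 (by linarith) hσ (by positivity) ?_
    rw [mul_one]
    exact moment_waitingTime_le hp hσ hε
  · exact C'.isWeaklyAverageSmooth_oracle h0 h1 (by linarith) hL.le (by positivity) (by positivity)
      hsmooth
  · refine le_trans ?_ (C'.le_roundsToStationary h0 h1 A hA hd hε (by rw [mul_one]))
    have : (d : ℝ) / (2 * W⁻¹) = d * W / 2 := by field_simp
    rw [this]
    exact_mod_cast Nat.ceil_le_ceil hr

theorem rate_le {p q L Δ σ ε : ℝ} (hp : 1 < p) (hq : 1 ≤ q) (hL : 0 < L) (hΔ : 0 < Δ) (hσ : 0 ≤ σ)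
    (hε : 0 < ε) : rate p q L Δ σ ε ≤ 4 ^ (p / (p - 1)) *
      (waitingTime p σ ε + 2 * (L * Δ / ε ^ 2 * waitingTime p σ ε ^ (1 / q))) := by
  have hs : 0 < p / (p - 1) := div_pos (by linarith) (by linarith)
  have hq0 : 0 < q := by linarith
  have hM : 0 < L * Δ / ε ^ 2 := by positivity
  have hW := one_le_waitingTime p σ ε
  have hWs : (σ / (4 * ε)) ^ (p / (p - 1)) ≤ waitingTime p σ ε := le_max_right _ _
  have hexp : p / (q * (p - 1)) = p / (p - 1) * (1 / q) := by
    have : p - 1 ≠ 0 := by linarith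
    field_simp
  have hsplit : (σ / ε) ^ (p / (p - 1)) = 4 ^ (p / (p - 1)) * (σ / (4 * ε)) ^ (p / (p - 1)) := by
    rw [← Real.mul_rpow (by norm_num) (by positivity)]
    congr 1
    field_simp
  have h4 : (1 : ℝ) ≤ 4 ^ (p / (p - 1)) := Real.one_le_rpow (by norm_num) hs.le
  set W := waitingTime p σ ε
  set M := L * Δ / ε ^ 2
  set c : ℝ := 4 ^ (p / (p - 1))
  have hWq : 1 ≤ W ^ (1 / q) := Real.one_le_rpow hW (by positivity)
  have h1 : (σ / ε) ^ (p / (p - 1)) ≤ c * W := by rw [hsplit]; gcongr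
  have h2 : M ≤ c * (M * W ^ (1 / q)) :=
    (le_mul_of_one_le_right hM.le hWq).trans (le_mul_of_one_le_left (by positivity) h4)
  have h3 : M * (σ / ε) ^ (p / (q * (p - 1))) ≤ c * (M * W ^ (1 / q)) := by
    rw [hexp, Real.rpow_mul (by positivity)]
    calc M * ((σ / ε) ^ (p / (p - 1))) ^ (1 / q) ≤ M * (c * W) ^ (1 / q) := by gcongr
      _ = M * (c ^ (1 / q) * W ^ (1 / q)) := by
          rw [Real.mul_rpow (by positivity) (by positivity)]
      _ ≤ M * (c * W ^ (1 / q)) := by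
          gcongr
          simpa using Real.rpow_le_rpow_of_exponent_le h4 (div_le_one_of_le₀ hq hq0.le)
      _ = _ := by ring
  unfold rate
  linarith

/-- A single instance that is hard for all zero-respecting algorithms. -/
theorem exists_hard_instance_rate {p q L Δ σ ε : ℝ} (hp : 1 < p) (hq : 1 ≤ q) (hL : 0 < L)
    (hΔ : 0 < Δ) (hσ : 0 ≤ σ) (hε : 0 < ε) (hεL : ε ≤ 1 / 20 * √(L * Δ)) (K : ℕ) :
    ∃ d : ℕ, 1 ≤ d ∧ ∃ F ∈ FunctionClass d Δ, ∃ O ∈ OracleClass F p q L σ,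
      ∀ A : Algorithm.{u} d K, A.IsZeroRespecting →
        ((⌈(4 ^ (p / (p - 1)))⁻¹ / 10000 * rate p q L Δ σ ε⌉₊ : ℕ) : ℕ∞)
          ≤ A.roundsToStationary O ε := by
  have hq0 : 0 < q := by linarith
  have hW := one_le_waitingTime p σ ε
  have hrate := rate_le hp hq hL hΔ hσ hε
  have hc : (0 : ℝ) < 4 ^ (p / (p - 1)) := by positivity
  have hM0 : 400 * ε ^ 2 ≤ L * Δ := by
    have h1 := pow_le_pow_left₀ hε.le hεL 2
    rw [mul_pow, Real.sq_sqrt (by positivity)] at h1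
    linarith
  have hrate' : (4 ^ (p / (p - 1)))⁻¹ / 10000 * rate p q L Δ σ ε ≤
      (waitingTime p σ ε + 2 * (L * Δ / ε ^ 2 * waitingTime p σ ε ^ (1 / q))) / 10000 := by
    calc _ ≤ (4 ^ (p / (p - 1)))⁻¹ / 10000 * (4 ^ (p / (p - 1)) *
          (waitingTime p σ ε + 2 * (L * Δ / ε ^ 2 * waitingTime p σ ε ^ (1 / q)))) := by gcongr
      _ = _ := by field_simp
  set M := L * Δ / ε ^ 2 with hM
  set U := waitingTime p σ ε ^ (1 - 1 / q) with hU
  have hW0 : 0 < waitingTime p σ ε := by linarith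
  have hU0 : 0 < U := by positivity
  have hUV : waitingTime p σ ε ^ (1 / q) * U = waitingTime p σ ε := by
    rw [hU, ← Real.rpow_add hW0, add_sub_cancel, Real.rpow_one]
  set V := waitingTime p σ ε ^ (1 / q)
  have hV0 : 0 < V := by positivity
  have hMpos : 0 < M := by positivity
  -- Does the budget `Δ` allow at least one link at the length scale that smoothness requires?
  by_cases hT : 384 * U ≤ M
  · set T := ⌊M / (384 * U)⌋₊
    have hT1 : 1 ≤ T := Nat.le_floor (by rw [Nat.cast_one, le_div_iff₀ (by positivity)]; linarith)
    have hTle : (T : ℝ) ≤ M / (384 * U) := Nat.floor_le (by positivity)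
    have hTlt : M / (384 * U) < T + 1 := Nat.lt_floor_add_one _
    have hT1' : (1 : ℝ) ≤ T := by exact_mod_cast hT1
    rw [le_div_iff₀ (by positivity), hM, le_div_iff₀ (by positivity)] at hTle
    rw [div_lt_iff₀ (by positivity)] at hTlt
    -- This `l` solves `24 * U * (2 * ε / l) = L`. The gap `2 * ε * l * 4 * T` then yields `384 = 2
    -- * 48 * 4`, and `T` is the largest length that fits.
    refine ⟨T, hT1, exists_hard_instance (chain T) hT1 (by norm_num) (by norm_num)
      (l := 48 * ε * U / L) hp hq hL hσ hε (by positivity) ?_ ?_ ?_ K⟩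
    · calc 2 * ε * (48 * ε * U / L) * (4 * T) = T * (384 * U) * ε ^ 2 / L := by ring
        _ ≤ L * Δ / L := by gcongr
        _ = Δ := by field_simp
    · have h := smoothness_le hW hq (s := 2 * ε / (48 * ε * U / L)) (by positivity)
      have e : 24 * U * (2 * ε / (48 * ε * U / L)) = L := by field_simp; norm_num
      rw [← hU, e] at h
      simpa only [mul_div_assoc', div_mul_eq_mul_div] using h
    · refine hrate'.trans ?_
      have h1 : M * V ≤ 768 * (T * waitingTime p σ ε) := by
        rw [← hUV]
        -- Rounding down costs at most a factor two because `T ≥ 1`.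
        have : M ≤ 768 * (T * U) := by nlinarith
        calc M * V ≤ 768 * (T * U) * V := by gcongr
          _ = _ := by ring
      have h2 : waitingTime p σ ε ≤ T * waitingTime p σ ε :=
        le_mul_of_one_le_left hW0.le hT1'
      linarith
  · push Not at hT
    -- The field is constant, so `l` need only satisfy `2 * ε * 8 / l = L`, with no power of `W`.
    -- The gap `128 * ε ^ 2 / L` is within budget by the smallness of `ε`.
    refine ⟨1, le_rfl, exists_hard_instance singleLink le_rfl (by norm_num) le_rfl
      (l := 16 * ε / L) hp hq hL hσ hε (by positivity) ?_ ?_ ?_ K⟩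
    · calc 2 * ε * (16 * ε / L) * 4 = 128 * ε ^ 2 / L := by ring
        _ ≤ L * Δ / L :=
            div_le_div_of_nonneg_right (by linarith [sq_nonneg ε]) hL.le
        _ = Δ := by field_simp
    · have e : 2 * ε * (8 / (16 * ε / L)) = L := by field_simp; norm_num
      rw [e, zero_div, mul_zero, mul_zero, add_zero, ← add_mul, sub_add_cancel, one_mul]
    · refine hrate'.trans ?_
      have h1 : M * V ≤ 384 * waitingTime p σ ε := by
        rw [← hUV]
        calc M * V ≤ 384 * U * V := by gcongr
          _ = _ := by ring
      push_cast
      linarith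

/-! ### From the hard instance to the theorem -/

theorem le_complexity {p q L Δ σ ε : ℝ} {K n d : ℕ} (hd : 1 ≤ d) {F : E d → ℝ}
    (hF : F ∈ FunctionClass d Δ) {O : StochasticOracle F} (hO : O ∈ OracleClass F p q L σ)
    (h : ∀ A : Algorithm.{u} d K, A.IsZeroRespecting → (n : ℕ∞) ≤ A.roundsToStationary O ε) :
    (n : ℕ∞) ≤ complexity.{u} p q K L Δ σ ε :=
  (le_iInf₂ h).trans <| le_iSup₂_of_le d hd <| le_iSup₂_of_le F hF <| le_iSup₂_of_le O hO le_rfl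

theorem ofReal_le_of_ceil_le {r : ℝ} {N : ℕ∞} (h : ((⌈r⌉₊ : ℕ) : ℕ∞) ≤ N) :
    ENNReal.ofReal r ≤ (N : ℝ≥0∞) :=
  calc ENNReal.ofReal r ≤ ENNReal.ofReal (⌈r⌉₊ : ℝ) := ENNReal.ofReal_le_ofReal (Nat.le_ceil r)
    _ = ((⌈r⌉₊ : ℕ∞) : ℝ≥0∞) := by simp
    _ ≤ N := by exact_mod_cast h

theorem rate_two_two (L Δ σ ε : ℝ) : rate 2 2 L Δ σ ε =
    σ ^ 2 / ε ^ 2 + L * Δ / ε ^ 2 + L * Δ * σ / ε ^ 3 := by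
  have h1 : (2 : ℝ) / (2 - 1) = (2 : ℕ) := by norm_num
  have h2 : (2 : ℝ) / (2 * (2 - 1)) = 1 := by norm_num
  rw [rate, h1, h2, Real.rpow_natCast, Real.rpow_one]
  ring

end HeavyTail

end

theorem theorem1 :
    ∃ c₁ : ℝ, 0 < c₁ ∧ ∀ p : ℝ, 1 < p → p ≤ 2 → ∃ c : ℝ, 0 < c ∧
      ∀ q : ℝ, 1 ≤ q → q ≤ 2 → ∀ K : ℕ, 1 ≤ K →
      ∀ L Δ σ ε : ℝ, 0 < L → 0 < Δ → 0 ≤ σ → 0 < ε → ε ≤ c₁ * Real.sqrt (L * Δ) →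
        (ENNReal.ofReal (c * HeavyTail.rate p q L Δ σ ε)
            ≤ (HeavyTail.complexity.{u} p q K L Δ σ ε : ℝ≥0∞)) ∧
        (∃ d : ℕ, 1 ≤ d ∧ ∃ F ∈ HeavyTail.FunctionClass d Δ,
          ∃ O ∈ HeavyTail.OracleClass F p q L σ,
          ∀ A : HeavyTail.Algorithm.{u} d K, A.IsZeroRespecting →
            ENNReal.ofReal (c * HeavyTail.rate p q L Δ σ ε)
              ≤ (A.roundsToStationary O ε : ℝ≥0∞)) ∧
        (p = 2 → q = 2 →
          ENNReal.ofReal (c * (σ ^ 2 / ε ^ 2 + L * Δ / ε ^ 2 + L * Δ * σ / ε ^ 3))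
            ≤ (HeavyTail.complexity.{u} p q K L Δ σ ε : ℝ≥0∞)) := by
  refine ⟨1 / 20, by norm_num, fun p hp _ => ⟨(4 ^ (p / (p - 1)))⁻¹ / 10000, by positivity, ?_⟩⟩
  intro q hq _ K _ L Δ σ ε hL hΔ hσ hε hεL
  obtain ⟨d, hd, F, hF, O, hO, h⟩ :=
    HeavyTail.exists_hard_instance_rate.{u} hp hq hL hΔ hσ hε hεL K
  have hcomplexity := HeavyTail.ofReal_le_of_ceil_le (HeavyTail.le_complexity hd hF hO h)
  refine ⟨hcomplexity, ⟨d, hd, F, hF, O, hO, fun A hA =>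
    HeavyTail.ofReal_le_of_ceil_le (h A hA)⟩, ?_⟩
  rintro rfl rfl
  rwa [HeavyTail.rate_two_two] at hcomplexity
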